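/- For $m\in\mathbb N=\{0,1,2,\dots\}$ let $P_m$ be the complex vector space of homogeneous polynomials of degree $m$ in $x_1,x_2$, with the inner product (conjugate linear in the first variable) given by $\langle x_1^{l}x_2^{m-l},x_1^{k}x_2^{m-k}\rangle=l!\,(m-l)!\,\delta_{lk}$. Identify $P_m\otimes P_n$ (with the tensor product inner product) with the space of polynomials of bidegree $(m,n)$ in $x=(x_1,x_2)$, $y=(y_1,y_2)$ via $f\otimes g\mapsto f(x)g(y)$, and put $$\Delta_{yx}=y_1\frac{\partial}{\partial x_1}+y_2\frac{\partial}{\partial x_2},\qquad \Gamma_{xy}f=(x_1y_2-y_1x_2)f .$$ For $0\le h\le\min\{m,n\}$ define $c_{m,n,h}$ recursively by $c_{m,0,0}=1$ and, for $n\ge1$, $$c_{m,n,h}=\frac1{(m+1)n}\begin{cases}c_{m+1,n-1,0}&h=0,\\ c_{m-1,n-1,h-1}+c_{m+1,n-1,h}&0<h<n,\\ c_{m-1,n-1,h-1}&h=n.\end{cases}$$ Let $r=m+n-2h$, let $\alpha_{m,n,h}:P_r\to P_m\otimes P_n$ be given by $\alpha_{m,n,h}(f)=\sqrt{c_{m,n,h}}\;\Gamma_{xy}^{h}\Delta_{yx}^{n-h}f(x)$,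 and let $\Phi_{m,n,h}:\mathrm{End}(P_r)\to\mathrm{End}(P_m)$ be $$\Phi_{m,n,h}(A)=\mathrm{Tr}_{P_n}\bigl(\alpha_{m,n,h}\,A\,\alpha_{m,n,h}^{*}\bigr),$$ where $\mathrm{Tr}_{P_n}$ is the partial trace over the second factor. For finite-dimensional Hilbert spaces $H,K$, the dual map of a linear map $\Phi:\mathrm{End}(H)\to\mathrm{End}(K)$ is the unique linear map $\Phi^{*}:\mathrm{End}(K)\to\mathrm{End}(H)$ with $\mathrm{tr}(B^{*}\Phi(A))=\mathrm{tr}(\Phi^{*}(B)^{*}A)$ for all $A\in\mathrm{End}(H)$, $B\in\mathrm{End}(K)$; a channel is a completely positive, trace preserving linear map. **Corollary 5.6.** Let $m,n,h\in\mathbb N$ with $0\le h\le\min\{m,n\}$ and $r=m+n-2h$. Then $$\Phi_{m,n,h}^{*}=\frac{r+1}{m+1}\,\Phi_{r,n,n-h}.$$ Moreover, $\Phi_{m,n,h}^{*}$ is a channel if and only if $n=2h$, and in that case (where $r=m$) $\Phi_{m,2h,h}^{*}=\Phi_{m,2h,h}$. -/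

import Mathlib

open scoped TensorProduct

namespace Eposic

noncomputable section

open MvPolynomial

/-! ### The spaces `P_m` of binary forms and their inner products -/

/-- `P m` is the complex vector space of homogeneous polynomials of degree `m` in the two
variables `x₁ = X 0`, `x₂ = X 1`. -/
abbrev P (m : ℕ) : Type := homogeneousSubmodule (Fin 2) ℂ m

/-- The exponent vector of the monomial `x₁ ^ a * x₂ ^ b`. -/
def expo (a b : ℕ) : Fin 2 →₀ ℕ := Finsupp.single 0 a + Finsupp.single 1 b

lemma expo_zero (a b : ℕ) : expo a b 0 = a := by simp [expo]

lemma expo_one (a b : ℕ) : expo a b 1 = b := by simp [expo]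

lemma eq_expo (d : Fin 2 →₀ ℕ) : d = expo (d 0) (d 1) := by
  ext i
  fin_cases i <;> simp [expo]

lemma expo_degree (a b : ℕ) : (expo a b).degree = a + b := by
  simp [Finsupp.degree_eq_sum, expo_zero, expo_one]

instance (m : ℕ) : FiniteDimensional ℂ (P m) :=
  Module.Finite.iff_fg.mpr (homogeneousSubmodule_fg _ _ m)

/-- The coefficient of `x₁ ^ l * x₂ ^ (m - l)` in `f`. -/
def cf {m : ℕ} (l : ℕ) (f : P m) : ℂ := coeff (expo l (m - l)) (f : MvPolynomial (Fin 2) ℂ)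

lemma cf_ext {m : ℕ} (f : P m) (h : ∀ l ∈ Finset.range (m + 1), cf l f = 0) : f = 0 := by
  apply Subtype.ext
  ext d
  by_cases hd : d.degree = m
  · have h2 : d 0 + d 1 = m := by
      rw [← hd, eq_expo d, expo_degree, expo_zero, expo_one]
    have h3 := h (d 0) (by simp; omega)
    have h4 : m - d 0 = d 1 := by omega
    rw [cf, h4, ← eq_expo] at h3
    simpa using h3
  · have := (mem_homogeneousSubmodule m _).1 f.2
    simpa using this.coeff_eq_zero hd

/-- The inner product on `P m` for which the monomials `x₁ ^ l * x₂ ^ (m - l)` are pairwise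
orthogonal, with squared norms `l! * (m - l)!`. It is conjugate linear in the first variable. -/
@[reducible] def innerCore (m : ℕ) : InnerProductSpace.Core ℂ (P m) where
  inner f g := ∑ l ∈ Finset.range (m + 1),
    ((l.factorial * (m - l).factorial : ℕ) : ℂ) * (starRingEnd ℂ (cf l f) * cf l g)
  conj_inner_symm f g := by
    simp only [map_sum, map_mul, Complex.conj_conj, map_natCast]
    exact Finset.sum_congr rfl fun _ _ => by ring
  re_inner_nonneg f := by
    simp only [map_sum]
    refine Finset.sum_nonneg fun l _ => ?_
    rw [Complex.conj_mul', ← Complex.ofReal_natCast, ← Complex.ofReal_pow, ← Complex.ofReal_mul]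
    simp only [RCLike.re_to_complex, Complex.ofReal_re]
    positivity
  add_left f g k := by
    rw [← Finset.sum_add_distrib]
    refine Finset.sum_congr rfl fun l _ => ?_
    simp only [cf, Submodule.coe_add, coeff_add, map_add]
    ring
  smul_left f g c := by
    rw [Finset.mul_sum]
    refine Finset.sum_congr rfl fun l _ => ?_
    simp only [cf, Submodule.coe_smul, coeff_smul, smul_eq_mul, map_mul]
    ring
  definite f h := by
    have h1 : (∑ l ∈ Finset.range (m + 1),
        ((l.factorial * (m - l).factorial : ℕ) : ℝ) * ‖cf l f‖ ^ 2) = 0 := by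
      have h2 : (∑ l ∈ Finset.range (m + 1), ((l.factorial * (m - l).factorial : ℕ) : ℂ) *
        (starRingEnd ℂ (cf l f) * cf l f)) = 0 := h
      simp only [Complex.conj_mul'] at h2
      exact_mod_cast h2
    rw [Finset.sum_eq_zero_iff_of_nonneg (fun l _ => by positivity)] at h1
    refine cf_ext f fun l hl => ?_
    have h3 := h1 l hl
    have h4 : ((l.factorial * (m - l).factorial : ℕ) : ℝ) ≠ 0 := by positivity
    simpa [h4] using (mul_eq_zero.1 h3).resolve_left h4

instance (m : ℕ) : NormedAddCommGroup (P m) := (innerCore m).toNormedAddCommGroup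

instance (m : ℕ) : InnerProductSpace ℂ (P m) := InnerProductSpace.ofCore (innerCore m).toCore

lemma inner_P {m : ℕ} (f g : P m) : inner ℂ f g = ∑ l ∈ Finset.range (m + 1),
    ((l.factorial * (m - l).factorial : ℕ) : ℂ) * (starRingEnd ℂ (cf l f) * cf l g) := rfl

/-! ### `P_m ⊗ P_n` as the space of polynomials of bidegree `(m, n)` -/

/-- Polynomials in `x = (x₁, x₂)` (the `Sum.inl` variables) and `y = (y₁, y₂)` (the `Sum.inr`
variables). -/
abbrev Pxy : Type := MvPolynomial (Fin 2 ⊕ Fin 2) ℂ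

/-- The weight that records the bidegree. -/
def bideg : Fin 2 ⊕ Fin 2 → ℕ × ℕ := Sum.elim (fun _ => (1, 0)) (fun _ => (0, 1))

/-- Polynomials that are homogeneous of degree `m` in `x` and of degree `n` in `y`. -/
abbrev BiP (m n : ℕ) : Submodule ℂ Pxy := weightedHomogeneousSubmodule ℂ bideg (m, n)

lemma rename_inl_mem {m : ℕ} (f : P m) :
    IsWeightedHomogeneous bideg (rename Sum.inl (f : MvPolynomial (Fin 2) ℂ) : Pxy) (m, 0) := by
  have hf : (f : MvPolynomial (Fin 2) ℂ).IsHomogeneous m := f.2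
  intro d hd
  obtain ⟨u, rfl, hu⟩ := coeff_rename_ne_zero _ _ _ hd
  have h1 := hf hu
  rw [eq_expo u] at h1 ⊢
  simp only [expo, Finsupp.mapDomain_add, Finsupp.mapDomain_single, map_add,
    Finsupp.weight_single] at h1 ⊢
  simpa [bideg] using h1

lemma rename_inr_mem {n : ℕ} (f : P n) :
    IsWeightedHomogeneous bideg (rename Sum.inr (f : MvPolynomial (Fin 2) ℂ) : Pxy) (0, n) := by
  have hf : (f : MvPolynomial (Fin 2) ℂ).IsHomogeneous n := f.2
  intro d hd
  obtain ⟨u, rfl, hu⟩ := coeff_rename_ne_zero _ _ _ hd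
  have h1 := hf hu
  rw [eq_expo u] at h1 ⊢
  simp only [expo, Finsupp.mapDomain_add, Finsupp.mapDomain_single, map_add,
    Finsupp.weight_single] at h1 ⊢
  simpa [bideg] using h1

/-- The linear map `P_m(x) ⊗ P_n(y) → ℂ[x, y]` with `f ⊗ g ↦ f(x) g(y)`. -/
def tensorToPxy (m n : ℕ) : P m ⊗[ℂ] P n →ₗ[ℂ] Pxy :=
  TensorProduct.lift
    ((LinearMap.mul ℂ Pxy).compl₁₂
      ((rename Sum.inl).toLinearMap ∘ₗ (homogeneousSubmodule (Fin 2) ℂ m).subtype)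
      ((rename Sum.inr).toLinearMap ∘ₗ (homogeneousSubmodule (Fin 2) ℂ n).subtype))

lemma tensorToPxy_tmul {m n : ℕ} (f : P m) (g : P n) :
    tensorToPxy m n (f ⊗ₜ g) =
      rename Sum.inl (f : MvPolynomial (Fin 2) ℂ) * rename Sum.inr (g : MvPolynomial (Fin 2) ℂ) :=
  rfl

lemma tensorToPxy_mem {m n : ℕ} (t : P m ⊗[ℂ] P n) : tensorToPxy m n t ∈ BiP m n := by
  induction t with
  | zero => simp
  | add a b ha hb => rw [map_add]; exact Submodule.add_mem _ ha hb
  | tmul f g =>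
    have := (rename_inl_mem f).mul (rename_inr_mem g)
    rw [tensorToPxy_tmul]
    simpa using this

/-- The monomial `x₁ ^ l * x₂ ^ (m - l)` of degree `m`. -/
def mono (m : ℕ) (l : Fin (m + 1)) : P m :=
  ⟨monomial (expo l (m - l)) 1, isHomogeneous_monomial _ (by rw [expo_degree]; omega)⟩

lemma sum_mono {m : ℕ} (f : P m) : f = ∑ l : Fin (m + 1), cf l f • mono m l := by
  rw [← sub_eq_zero]
  refine cf_ext _ fun k hk => ?_
  have hk' : k < m + 1 := by simpa using hk
  have hcf : ∀ l : Fin (m + 1), cf k (mono m l) = if (⟨k, hk'⟩ : Fin (m + 1)) = l then 1 else 0 := by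
    intro l
    rw [cf, mono, coeff_monomial]
    congr 1
    apply propext
    constructor
    · intro h
      have := DFunLike.congr_fun h 0
      rw [expo_zero, expo_zero] at this
      exact Fin.ext this.symm
    · rintro rfl; rfl
  let L : P m →ₗ[ℂ] ℂ := lcoeff ℂ (expo k (m - k)) ∘ₗ Submodule.subtype _
  have hL : ∀ g : P m, cf k g = L g := fun g => rfl
  rw [hL, map_sub, map_sum]
  simp only [map_smul]
  simp only [← hL, hcf]
  simp

/-- The exponent vector of `x₁ ^ a * x₂ ^ b * y₁ ^ c * y₂ ^ d`. -/
def expo4 (a b c d : ℕ) : (Fin 2 ⊕ Fin 2) →₀ ℕ :=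
  (expo a b).mapDomain Sum.inl + (expo c d).mapDomain Sum.inr

lemma tensorToPxy_mono {m n : ℕ} (s : Fin (m + 1)) (t : Fin (n + 1)) :
    tensorToPxy m n (mono m s ⊗ₜ mono n t) = monomial (expo4 s (m - s) t (n - t)) 1 := by
  rw [tensorToPxy_tmul, mono, mono, rename_monomial, rename_monomial, monomial_mul, one_mul, expo4]

lemma expo4_inl (a b c d : ℕ) : expo4 a b c d (Sum.inl 0) = a := by
  simp [expo4, expo, Finsupp.mapDomain_add]

lemma expo4_inr (a b c d : ℕ) : expo4 a b c d (Sum.inr 0) = c := by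
  simp [expo4, expo, Finsupp.mapDomain_add]

lemma eq_expo4 (e : (Fin 2 ⊕ Fin 2) →₀ ℕ) :
    e = expo4 (e (Sum.inl 0)) (e (Sum.inl 1)) (e (Sum.inr 0)) (e (Sum.inr 1)) := by
  ext i
  rcases i with i | i <;> fin_cases i <;> simp [expo4, expo, Finsupp.mapDomain_add]

lemma weight_expo4 (a b c d : ℕ) :
    Finsupp.weight bideg (expo4 a b c d) = (a + b, c + d) := by
  simp [expo4, expo, Finsupp.mapDomain_add, Finsupp.weight_single, bideg]

lemma tensorToPxy_injective (m n : ℕ) : Function.Injective (tensorToPxy m n) := by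
  let inv : Pxy →ₗ[ℂ] P m ⊗[ℂ] P n := ∑ s : Fin (m + 1), ∑ t : Fin (n + 1),
    (lcoeff ℂ (expo4 s (m - s) t (n - t))).smulRight (mono m s ⊗ₜ[ℂ] mono n t)
  have hinv : ∀ s t, inv (tensorToPxy m n (mono m s ⊗ₜ mono n t)) = mono m s ⊗ₜ mono n t := by
    intro s t
    have key : ∀ (s' : Fin (m + 1)) (t' : Fin (n + 1)),
        expo4 s (m - s) t (n - t) = expo4 s' (m - s') t' (n - t') ↔ s = s' ∧ t = t' := by
      intro s' t'
      constructor
      · intro h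
        have h1 := DFunLike.congr_fun h (Sum.inl 0)
        have h2 := DFunLike.congr_fun h (Sum.inr 0)
        rw [expo4_inl, expo4_inl] at h1
        rw [expo4_inr, expo4_inr] at h2
        exact ⟨Fin.ext h1, Fin.ext h2⟩
      · rintro ⟨rfl, rfl⟩; rfl
    simp only [inv, LinearMap.sum_apply, LinearMap.smulRight_apply, tensorToPxy_mono, lcoeff_apply,
      coeff_monomial, key]
    rw [Finset.sum_eq_single s, Finset.sum_eq_single t]
    · simp
    · intro t' _ h; simp [h.symm]
    · simp
    · intro s' _ h; simp [h.symm]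
    · simp
  have hid : inv ∘ₗ tensorToPxy m n = LinearMap.id := by
    refine TensorProduct.ext' fun f g => ?_
    rw [sum_mono f, sum_mono g]
    simp only [TensorProduct.sum_tmul, TensorProduct.tmul_sum, ← TensorProduct.smul_tmul',
      TensorProduct.tmul_smul, map_sum, map_smul, LinearMap.comp_apply, hinv, LinearMap.id_apply]
  exact Function.LeftInverse.injective (g := inv) (fun t => DFunLike.congr_fun hid t)

lemma tensorToPxy_surjective {m n : ℕ} (F : Pxy) (hF : F ∈ BiP m n) :
    ∃ t, tensorToPxy m n t = F := by
  change F ∈ LinearMap.range (tensorToPxy m n)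
  rw [F.as_sum]
  refine Submodule.sum_mem _ fun e he => ?_
  have h1 := hF (mem_support_iff.1 he)
  rw [eq_expo4 e, weight_expo4, Prod.mk.injEq] at h1
  refine ⟨coeff e F • (mono m ⟨e (Sum.inl 0), by omega⟩ ⊗ₜ mono n ⟨e (Sum.inr 0), by omega⟩), ?_⟩
  rw [map_smul, tensorToPxy_mono, smul_monomial, smul_eq_mul, mul_one]
  have h2 : m - e (Sum.inl 0) = e (Sum.inl 1) := by omega
  have h3 : n - e (Sum.inr 0) = e (Sum.inr 1) := by omega
  simp only [h2, h3]
  rw [← eq_expo4 e]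

/-- The identification of `P_m(x) ⊗ P_n(y)` with the polynomials of bidegree `(m, n)`. -/
def tensorEquiv (m n : ℕ) : P m ⊗[ℂ] P n ≃ₗ[ℂ] BiP m n :=
  LinearEquiv.ofBijective ((tensorToPxy m n).codRestrict (BiP m n) tensorToPxy_mem)
    ⟨fun a b h => tensorToPxy_injective m n (congrArg Subtype.val h),
     fun F => (tensorToPxy_surjective F.1 F.2).imp fun _ h => Subtype.ext h⟩

/-! ### The isometries `α_{m,n,h}` -/

/-- `Δ_{yx} = y₁ ∂/∂x₁ + y₂ ∂/∂x₂`. -/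
def deltaYX : Pxy →ₗ[ℂ] Pxy :=
  LinearMap.mulLeft ℂ (X (Sum.inr 0)) ∘ₗ (pderiv (Sum.inl 0)).toLinearMap +
    LinearMap.mulLeft ℂ (X (Sum.inr 1)) ∘ₗ (pderiv (Sum.inl 1)).toLinearMap

/-- `Γ_{xy}`, multiplication by `x₁ y₂ - y₁ x₂`. -/
def gammaXY : Pxy →ₗ[ℂ] Pxy :=
  LinearMap.mulLeft ℂ
    (X (Sum.inl 0) * X (Sum.inr 1) - X (Sum.inr 0) * X (Sum.inl 1))

lemma deltaYX_mem {a b : ℕ} {F : Pxy} (hF : F ∈ BiP (a + 1) b) : deltaYX F ∈ BiP a (b + 1) := by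
  have hF' : IsWeightedHomogeneous bideg F (a + 1, b) := hF
  have h (i : Fin 2) :
      IsWeightedHomogeneous bideg (X (Sum.inr i) * pderiv (Sum.inl i) F) (a, b + 1) := by
    have h1 : IsWeightedHomogeneous bideg (pderiv (Sum.inl i) F) (a, b) :=
      hF'.pderiv (by simp [bideg])
    have h2 := (isWeightedHomogeneous_X ℂ bideg (Sum.inr i)).mul h1
    simpa [bideg, add_comm] using h2
  exact (h 0).add (h 1)

lemma gammaXY_mem {a b : ℕ} {F : Pxy} (hF : F ∈ BiP a b) :
    gammaXY F ∈ BiP (a + 1) (b + 1) := by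
  have hF' : IsWeightedHomogeneous bideg F (a, b) := hF
  have h1 : IsWeightedHomogeneous bideg
      (X (Sum.inl 0) * X (Sum.inr 1) - X (Sum.inr 0) * X (Sum.inl 1) : Pxy) (1, 1) := by
    apply IsWeightedHomogeneous.sub
    · simpa [bideg] using
        (isWeightedHomogeneous_X ℂ bideg (Sum.inl 0)).mul
          (isWeightedHomogeneous_X ℂ bideg (Sum.inr 1))
    · simpa [bideg] using
        (isWeightedHomogeneous_X ℂ bideg (Sum.inr 0)).mul
          (isWeightedHomogeneous_X ℂ bideg (Sum.inl 1))
  have h2 := h1.mul hF'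
  simpa [gammaXY, add_comm] using h2

lemma deltaYX_pow_mem (k : ℕ) {a b : ℕ} {F : Pxy} (hF : F ∈ BiP (a + k) b) :
    (deltaYX ^ k) F ∈ BiP a (b + k) := by
  induction k generalizing b F with
  | zero => simpa using hF
  | succ k ih =>
    rw [pow_succ, Module.End.mul_apply]
    have := ih (b := b + 1) (deltaYX_mem (a := a + k) hF)
    rwa [show b + (k + 1) = b + 1 + k by omega]

lemma gammaXY_pow_mem (k : ℕ) {a b : ℕ} {F : Pxy} (hF : F ∈ BiP a b) :
    (gammaXY ^ k) F ∈ BiP (a + k) (b + k) := by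
  induction k with
  | zero => simpa using hF
  | succ k ih =>
    rw [pow_succ', Module.End.mul_apply]
    exact gammaXY_mem ih

/-- The coefficients `c_{m,n,h}`, for `h ≤ min m n`, defined by recursion on `n`.
Values outside this range are irrelevant. -/
def cgCoeff : ℕ → ℕ → ℕ → ℝ
  | _, 0, _ => 1
  | m, n + 1, 0 => 1 / (((m : ℝ) + 1) * ((n : ℝ) + 1)) * cgCoeff (m + 1) n 0
  | m, n + 1, h + 1 =>
    if h + 1 < n + 1 then
      1 / (((m : ℝ) + 1) * ((n : ℝ) + 1)) * (cgCoeff (m - 1) n h + cgCoeff (m + 1) n (h + 1))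
    else
      1 / (((m : ℝ) + 1) * ((n : ℝ) + 1)) * cgCoeff (m - 1) n h

/-- The polynomial map `f(x) ↦ √c_{m,n,h} Γ_{xy}^h Δ_{yx}^{n-h} f(x)`. -/
def alphaPoly (m n h : ℕ) {r : ℕ} : P r →ₗ[ℂ] Pxy :=
  ((Real.sqrt (cgCoeff m n h) : ℝ) : ℂ) • ((gammaXY ^ h) ∘ₗ (deltaYX ^ (n - h)) ∘ₗ
    (rename Sum.inl).toLinearMap ∘ₗ (homogeneousSubmodule (Fin 2) ℂ r).subtype)

lemma alphaPoly_mem {m n h r : ℕ} (hh : h ≤ min m n) (hr : r = m + n - 2 * h) (f : P r) :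
    alphaPoly m n h f ∈ BiP m n := by
  have hm : h ≤ m := le_trans hh (min_le_left _ _)
  have hn : h ≤ n := le_trans hh (min_le_right _ _)
  refine Submodule.smul_mem _ _ ?_
  have h1 : (rename Sum.inl (f : MvPolynomial (Fin 2) ℂ) : Pxy) ∈ BiP ((m - h) + (n - h)) 0 := by
    rw [show (m - h) + (n - h) = r by omega]
    exact rename_inl_mem f
  have h2 := gammaXY_pow_mem h (deltaYX_pow_mem (n - h) h1)
  rwa [show m - h + h = m by omega, show 0 + (n - h) + h = n by omega] at h2

/-- `α_{m,n,h} : P_r → P_m ⊗ P_n`, where `r = m + n - 2h`. -/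
def alpha (m n h r : ℕ) (hh : h ≤ min m n) (hr : r = m + n - 2 * h) :
    P r →ₗ[ℂ] P m ⊗[ℂ] P n :=
  (tensorEquiv m n).symm.toLinearMap ∘ₗ (alphaPoly m n h).codRestrict (BiP m n) (alphaPoly_mem hh hr)

lemma tensorToPxy_alpha (m n h r : ℕ) (hh : h ≤ min m n) (hr : r = m + n - 2 * h) (f : P r) :
    tensorToPxy m n (alpha m n h r hh hr f) =
      ((Real.sqrt (cgCoeff m n h) : ℝ) : ℂ) •
        (gammaXY ^ h) ((deltaYX ^ (n - h)) (rename Sum.inl (f : MvPolynomial (Fin 2) ℂ))) :=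
  congrArg Subtype.val ((tensorEquiv m n).apply_symm_apply
    ⟨alphaPoly m n h f, alphaPoly_mem hh hr f⟩)

/-! ### Partial trace, Hilbert-Schmidt duality and quantum channels -/

section General

variable {H K : Type*} [NormedAddCommGroup H] [InnerProductSpace ℂ H] [FiniteDimensional ℂ H]
  [NormedAddCommGroup K] [InnerProductSpace ℂ K] [FiniteDimensional ℂ K]

/-- The partial trace over the second factor, `A₁ ⊗ A₂ ↦ tr(A₂) A₁`. -/
def partialTrace (H K : Type*) [NormedAddCommGroup H] [InnerProductSpace ℂ H]
    [FiniteDimensional ℂ H] [NormedAddCommGroup K] [InnerProductSpace ℂ K]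
    [FiniteDimensional ℂ K] :
    (H ⊗[ℂ] K →ₗ[ℂ] H ⊗[ℂ] K) →ₗ[ℂ] (H →ₗ[ℂ] H) :=
  (TensorProduct.rid ℂ (H →ₗ[ℂ] H)).toLinearMap ∘ₗ
    LinearMap.lTensor (H →ₗ[ℂ] H) (LinearMap.trace ℂ K) ∘ₗ
      (homTensorHomEquiv ℂ H K H K).symm.toLinearMap

lemma partialTrace_map (A : H →ₗ[ℂ] H) (B : K →ₗ[ℂ] K) :
    partialTrace H K (TensorProduct.map A B) = LinearMap.trace ℂ K B • A := by
  have h : TensorProduct.map A B = homTensorHomEquiv ℂ H K H K (A ⊗ₜ B) := by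
    rw [homTensorHomEquiv_apply]; rfl
  rw [h, partialTrace, LinearMap.comp_apply, LinearMap.comp_apply, LinearEquiv.coe_coe,
    LinearEquiv.coe_coe, LinearEquiv.symm_apply_apply, LinearMap.lTensor_tmul,
    TensorProduct.rid_tmul]

/-- The Hilbert-Schmidt inner product `⟨A | B⟩ = tr(A* B)` on linear maps. -/
@[reducible] def hsCore : InnerProductSpace.Core ℂ (H →ₗ[ℂ] K) where
  inner A B := LinearMap.trace ℂ H (LinearMap.adjoint A ∘ₗ B)
  conj_inner_symm A B := by
    rw [LinearMap.trace_eq_sum_inner _ (stdOrthonormalBasis ℂ H),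
      LinearMap.trace_eq_sum_inner _ (stdOrthonormalBasis ℂ H), map_sum]
    refine Finset.sum_congr rfl fun i _ => ?_
    simp [LinearMap.adjoint_inner_right]
  re_inner_nonneg A := by
    rw [LinearMap.trace_eq_sum_inner _ (stdOrthonormalBasis ℂ H), map_sum]
    refine Finset.sum_nonneg fun i _ => ?_
    rw [LinearMap.comp_apply, LinearMap.adjoint_inner_right]
    exact inner_self_nonneg
  add_left A B C := by
    rw [map_add, LinearMap.add_comp, map_add]
  smul_left A B c := by
    rw [map_smulₛₗ, LinearMap.smul_comp, map_smul, smul_eq_mul]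
  definite A h := by
    change LinearMap.trace ℂ H (LinearMap.adjoint A ∘ₗ A) = 0 at h
    rw [LinearMap.trace_eq_sum_inner _ (stdOrthonormalBasis ℂ H)] at h
    simp only [LinearMap.comp_apply, LinearMap.adjoint_inner_right,
      inner_self_eq_norm_sq_to_K] at h
    have h1 : ∑ i, ‖A (stdOrthonormalBasis ℂ H i)‖ ^ 2 = 0 := by
      rw [← Complex.ofReal_inj]
      simpa using h
    rw [Finset.sum_eq_zero_iff_of_nonneg (fun i _ => by positivity)] at h1
    refine (stdOrthonormalBasis ℂ H).toBasis.ext fun i => ?_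
    simpa using h1 i (Finset.mem_univ i)

instance hsNormedAddCommGroup : NormedAddCommGroup (H →ₗ[ℂ] K) :=
  (hsCore (H := H) (K := K)).toNormedAddCommGroup

instance hsInnerProductSpace : InnerProductSpace ℂ (H →ₗ[ℂ] K) :=
  InnerProductSpace.ofCore (hsCore (H := H) (K := K)).toCore

lemma inner_hs (A B : H →ₗ[ℂ] K) :
    inner ℂ A B = LinearMap.trace ℂ H (LinearMap.adjoint A ∘ₗ B) := rfl

/-- The dual map `Φ* : End(K) → End(H)` of `Φ : End(H) → End(K)`: its adjoint for the
Hilbert-Schmidt inner products. -/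
def dualMap (Φ : (H →ₗ[ℂ] H) →ₗ[ℂ] (K →ₗ[ℂ] K)) : (K →ₗ[ℂ] K) →ₗ[ℂ] (H →ₗ[ℂ] H) :=
  LinearMap.adjoint Φ

/-- The defining property of the dual map: `⟨B | Φ(A)⟩ = ⟨Φ*(B) | A⟩`, and its uniqueness. -/
lemma eq_dualMap_iff (Φ : (H →ₗ[ℂ] H) →ₗ[ℂ] (K →ₗ[ℂ] K)) (Ψ : (K →ₗ[ℂ] K) →ₗ[ℂ] (H →ₗ[ℂ] H)) :
    Ψ = dualMap Φ ↔ ∀ A B, LinearMap.trace ℂ K (LinearMap.adjoint B ∘ₗ Φ A) =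
      LinearMap.trace ℂ H (LinearMap.adjoint (Ψ B) ∘ₗ A) := by
  rw [dualMap, LinearMap.eq_adjoint_iff]
  exact ⟨fun h A B => (h B A).symm, fun h B A => (h A B).symm⟩

/-- `Φ ⊗ id_k : End(H) ⊗ M_k → End(K) ⊗ M_k`, with `End(H) ⊗ M_k` identified with
`End(H ⊗ ℂ^k)`. -/
def ampliation (Φ : (H →ₗ[ℂ] H) →ₗ[ℂ] (K →ₗ[ℂ] K)) (k : ℕ) :
    (H ⊗[ℂ] EuclideanSpace ℂ (Fin k) →ₗ[ℂ] H ⊗[ℂ] EuclideanSpace ℂ (Fin k)) →ₗ[ℂ]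
      (K ⊗[ℂ] EuclideanSpace ℂ (Fin k) →ₗ[ℂ] K ⊗[ℂ] EuclideanSpace ℂ (Fin k)) :=
  (homTensorHomEquiv ℂ K (EuclideanSpace ℂ (Fin k)) K (EuclideanSpace ℂ (Fin k))).toLinearMap ∘ₗ
    LinearMap.rTensor _ Φ ∘ₗ
      (homTensorHomEquiv ℂ H (EuclideanSpace ℂ (Fin k)) H
        (EuclideanSpace ℂ (Fin k))).symm.toLinearMap

/-- Complete positivity: `Φ ⊗ id_k` maps positive operators to positive operators for every
`k ≥ 1`. -/
def IsCompletelyPositive (Φ : (H →ₗ[ℂ] H) →ₗ[ℂ] (K →ₗ[ℂ] K)) : Prop :=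
  ∀ k : ℕ, 1 ≤ k → ∀ A, A.IsPositive → (ampliation Φ k A).IsPositive

/-- A quantum channel is a completely positive trace preserving linear map. -/
def IsChannel (Φ : (H →ₗ[ℂ] H) →ₗ[ℂ] (K →ₗ[ℂ] K)) : Prop :=
  IsCompletelyPositive Φ ∧ ∀ A, LinearMap.trace ℂ K (Φ A) = LinearMap.trace ℂ H A

end General

/-! ### The EPOSIC channels -/

/-- `Φ_{m,n,h} : End(P_r) → End(P_m)`, `A ↦ Tr_{P_n}(α A α*)` with `α = α_{m,n,h}` and
`r = m + n - 2h`. -/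
def Phi (m n h r : ℕ) (hh : h ≤ min m n) (hr : r = m + n - 2 * h) :
    (P r →ₗ[ℂ] P r) →ₗ[ℂ] (P m →ₗ[ℂ] P m) :=
  partialTrace (P m) (P n) ∘ₗ
    LinearMap.lcomp ℂ (P m ⊗[ℂ] P n) (LinearMap.adjoint (alpha m n h r hh hr)) ∘ₗ
      LinearMap.llcomp ℂ (P r) (P r) (P m ⊗[ℂ] P n) (alpha m n h r hh hr)

lemma Phi_apply (m n h r : ℕ) (hh : h ≤ min m n) (hr : r = m + n - 2 * h) (A : P r →ₗ[ℂ] P r) :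
    Phi m n h r hh hr A = partialTrace (P m) (P n)
      (alpha m n h r hh hr ∘ₗ A ∘ₗ LinearMap.adjoint (alpha m n h r hh hr)) := rfl

end

end Eposic

open scoped TensorProduct

namespace Eposic

noncomputable section

open MvPolynomial

/-! Write α for α_{m,n,h}. Cyclicity of the trace shows that the dual of A ↦ Tr_{P_n}(αAα*) is B ↦
α*(B ⊗ 1)α, so the task is to recognize this map as a multiple of Φ_{r,n,n-h}. The heart is a
crossing symmetry (`inner_tmul_alpha`): moving P_n to the other side by an antiunitary twist turns
the matrix elements of α_{m,n,h} into those of α_{r,n,n-h}, up to the constant (-1)^{n-h}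
√((r+1)/(m+1)). It is checked on powers of linear forms, which span P_m and are reproducing kernels:
α sends a power of a linear form to a product of powers of a bracket x₁y₂ - y₁x₂ and two dot
products, and the twist exchanges the bracket with one of the dot products. The constant comes from
the closed form of c_{m,n,h}. Expanding α in an orthonormal basis of P_n then exhibits the Kraus
operators of Φ_{r,n,n-h} (`alpha_eq_sum`), and `smul_Phi_eq` follows. For the channel criterion, α
is an isometry (`inner_alpha_alpha`), by commutation relations between Γ, Δ and their Fischer
adjoints. Hence every Φ preserves traces, the dual scales them by (r+1)/(m+1), and this is 1 exactly
when r = m, that is n = 2h. Complete positivity is automatic from the Kraus form. -/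

/-! ### The coefficients in closed form -/

/-- Closed form of the coefficients `c_{m,n,h}`, with `m = h + p` and `n = h + q`. -/
lemma cgCoeff_eq (h p q : ℕ) : cgCoeff (h + p) (h + q) h =
    (p.factorial * (p + q + 1) : ℝ) /
      (h.factorial * q.factorial * (p + q + h + 1).factorial) := by
  -- The recursion on n shifts m and h, so h, p and q must stay free in the induction.
  suffices H : ∀ n h p q : ℕ, h + q = n → cgCoeff (h + p) n h =
      (p.factorial * (p + q + 1) : ℝ) /
        (h.factorial * q.factorial * (p + q + h + 1).factorial) from H _ h p q rfl
  intro n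
  induction n with
  | zero =>
    intro h p q hn
    obtain ⟨rfl, rfl⟩ : h = 0 ∧ q = 0 := by omega
    simp only [cgCoeff, Nat.factorial_succ, Nat.factorial_zero]
    have : (p.factorial : ℝ) ≠ 0 := by positivity
    push_cast
    simp only [add_zero]
    field_simp
  | succ n ih =>
    intro h p q hn
    have hp : (p.factorial : ℝ) ≠ 0 := by positivity
    rcases h with _ | h
    · obtain rfl : q = n + 1 := by omega
      have := ih 0 (p + 1) n (by omega)
      rw [cgCoeff, show 0 + p + 1 = 0 + (p + 1) by omega, this]
      rw [show p + 1 + n + 0 + 1 = p + (n + 1) + 0 + 1 by omega]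
      rw [Nat.factorial_succ p, Nat.factorial_succ n]
      push_cast
      have : (n.factorial : ℝ) ≠ 0 := by positivity
      have : ((p + (n + 1) + 0 + 1).factorial : ℝ) ≠ 0 := by positivity
      field_simp
      ring
    · have h1 := ih h p q (by omega)
      have e1 : h + 1 + p - 1 = h + p := by omega
      have hh : (h.factorial : ℝ) ≠ 0 := by positivity
      have hN : ((p + q + h + 1).factorial : ℝ) ≠ 0 := by positivity
      -- q = 0 is the boundary case h = n, where the recursion has a single term.
      rcases q with _ | q
      · obtain rfl : h = n := by omega
        rw [cgCoeff, if_neg (lt_irrefl _), e1, h1]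
        rw [show p + 0 + (h + 1) + 1 = (p + 0 + h + 1) + 1 by omega,
          Nat.factorial_succ (p + 0 + h + 1), Nat.factorial_succ h]
        push_cast
        field_simp
        ring
      · have h2 := ih (h + 1) (p + 1) q (by omega)
        rw [cgCoeff, if_pos (by omega), e1, h1,
          show h + 1 + p + 1 = h + 1 + (p + 1) by omega, h2]
        have hq : (q.factorial : ℝ) ≠ 0 := by positivity
        obtain rfl : n = h + 1 + q := by omega
        rw [show p + (q + 1) + (h + 1) + 1 = (p + (q + 1) + h + 1) + 1 by omega,
          show p + 1 + q + (h + 1) + 1 = (p + (q + 1) + h + 1) + 1 by omega,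
          Nat.factorial_succ (p + (q + 1) + h + 1), Nat.factorial_succ h, Nat.factorial_succ q,
          Nat.factorial_succ p]
        push_cast
        field_simp
        ring

lemma pderiv_comm {σ : Type*} (i j : σ) (F : MvPolynomial σ ℂ) :
    pderiv i (pderiv j F) = pderiv j (pderiv i F) := by
  classical
  ext d
  simp only [coeff_pderiv, Finsupp.add_apply]
  rw [add_right_comm d]
  by_cases h : i = j
  · subst h; rfl
  · simp [h, Ne.symm h]
    ring

/-! ### The Fischer inner product -/

section Fischer

variable {σ : Type*} [Fintype σ]

/-- The product of the factorials of the exponents. -/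
def multiFactorial (d : σ →₀ ℕ) : ℂ := ∏ i, ((d i).factorial : ℂ)

lemma multiFactorial_add_single (d : σ →₀ ℕ) (i : σ) :
    multiFactorial (d + Finsupp.single i 1) = (d i + 1) * multiFactorial d := by
  classical
  rw [multiFactorial, multiFactorial, ← Finset.mul_prod_erase _ _ (Finset.mem_univ i),
    ← Finset.mul_prod_erase Finset.univ _ (Finset.mem_univ i), ← mul_assoc]
  congr 1
  · simp [Nat.factorial_succ]
  · refine Finset.prod_congr rfl fun j hj => ?_
    have : i ≠ j := (Finset.ne_of_mem_erase hj).symm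
    simp [this]

/-- The sesquilinear form for which the monomials are orthogonal, with squared norms the products
of the factorials of the exponents. -/
def fischer (F : MvPolynomial σ ℂ) : MvPolynomial σ ℂ →ₗ[ℂ] ℂ :=
  (basisMonomials σ ℂ).constr ℂ fun d => multiFactorial d * starRingEnd ℂ (coeff d F)

lemma fischer_monomial_right (F : MvPolynomial σ ℂ) (d : σ →₀ ℕ) :
    fischer F (monomial d 1) = multiFactorial d * starRingEnd ℂ (coeff d F) := by
  have : (monomial d 1 : MvPolynomial σ ℂ) = basisMonomials σ ℂ d := by simp
  rw [this, fischer, Module.Basis.constr_basis]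

lemma fischer_congr {F F' : MvPolynomial σ ℂ} {T T' : MvPolynomial σ ℂ →ₗ[ℂ] MvPolynomial σ ℂ}
    (h : ∀ d, fischer F (T (monomial d 1)) = fischer F' (T' (monomial d 1)))
    (G : MvPolynomial σ ℂ) : fischer F (T G) = fischer F' (T' G) :=
  DFunLike.congr_fun ((basisMonomials σ ℂ).ext (f₁ := fischer F ∘ₗ T) (f₂ := fischer F' ∘ₗ T')
    (by simpa using h)) G

lemma fischer_add_left (F F' G : MvPolynomial σ ℂ) :
    fischer (F + F') G = fischer F G + fischer F' G := by
  have : fischer (F + F') = fischer F + fischer F' := by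
    refine (basisMonomials σ ℂ).ext fun d => ?_
    simp [fischer_monomial_right, mul_add]
  rw [this, LinearMap.add_apply]

lemma fischer_smul_left (c : ℂ) (F G : MvPolynomial σ ℂ) :
    fischer (c • F) G = starRingEnd ℂ c * fischer F G := by
  have : fischer (c • F) = starRingEnd ℂ c • fischer F := by
    refine (basisMonomials σ ℂ).ext fun d => ?_
    simp [fischer_monomial_right]
    ring
  rw [this, LinearMap.smul_apply, smul_eq_mul]

lemma fischer_zero_left (G : MvPolynomial σ ℂ) : fischer 0 G = 0 := by
  simpa using fischer_smul_left 0 0 G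

lemma fischer_sub_left (F F' G : MvPolynomial σ ℂ) :
    fischer (F - F') G = fischer F G - fischer F' G := by
  have := fischer_add_left (F - F') F' G
  rw [sub_add_cancel] at this
  rw [this, add_sub_cancel_right]

/-- Raising the i-th exponent d i by one multiplies the squared norm of a monomial by d i + 1, the
factor that differentiation produces. -/
lemma fischer_pderiv_left (i : σ) (F G : MvPolynomial σ ℂ) :
    fischer (pderiv i F) G = fischer F (X i * G) := by
  refine fischer_congr (T := LinearMap.id) (T' := LinearMap.mulLeft ℂ (X i)) (fun d => ?_) G
  have : (X i * monomial d 1 : MvPolynomial σ ℂ) = monomial (d + Finsupp.single i 1) 1 := by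
    rw [X, monomial_mul, one_mul, add_comm]
  rw [LinearMap.id_apply, LinearMap.mulLeft_apply, this, fischer_monomial_right,
    fischer_monomial_right, multiFactorial_add_single, coeff_pderiv]
  simp
  ring

lemma fischer_X_mul_left (i : σ) (F G : MvPolynomial σ ℂ) :
    fischer (X i * F) G = fischer F (pderiv i G) := by
  classical
  refine fischer_congr (T := LinearMap.id) (T' := (pderiv i).toLinearMap) (fun d => ?_) G
  rw [LinearMap.id_apply, fischer_monomial_right, coeff_X_mul']
  change _ = fischer F (pderiv i (monomial d 1))
  rw [pderiv_monomial, one_mul]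
  split_ifs with hi
  · have h1 : 1 ≤ d i := Nat.one_le_iff_ne_zero.2 (Finsupp.mem_support_iff.1 hi)
    obtain ⟨e, rfl⟩ : ∃ e, d = e + Finsupp.single i 1 :=
      ⟨d - Finsupp.single i 1, (tsub_add_cancel_of_le (by simpa using h1)).symm⟩
    rw [add_tsub_cancel_right, multiFactorial_add_single]
    have : monomial e (((e + Finsupp.single i 1 : σ →₀ ℕ) i : ℕ) : ℂ) =
        ((e i : ℂ) + 1) • monomial e (1 : ℂ) := by
      rw [smul_monomial]
      simp
    rw [this, map_smul, fischer_monomial_right, smul_eq_mul, mul_assoc]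
  · simp [Finsupp.notMem_support_iff.1 hi]

end Fischer

/-! ### The Fischer adjoints of `Γ_{xy}` and `Δ_{yx}` -/

/-- Cayley's operator `∂²/∂x₁∂y₂ - ∂²/∂y₁∂x₂`. -/
def omegaXY : Pxy →ₗ[ℂ] Pxy :=
  (pderiv (Sum.inl 0)).toLinearMap ∘ₗ (pderiv (Sum.inr 1)).toLinearMap -
    (pderiv (Sum.inr 0)).toLinearMap ∘ₗ (pderiv (Sum.inl 1)).toLinearMap

/-- `Δ_{xy} = x₁ ∂/∂y₁ + x₂ ∂/∂y₂`. -/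
def deltaXY : Pxy →ₗ[ℂ] Pxy :=
  LinearMap.mulLeft ℂ (X (Sum.inl 0)) ∘ₗ (pderiv (Sum.inr 0)).toLinearMap +
    LinearMap.mulLeft ℂ (X (Sum.inl 1)) ∘ₗ (pderiv (Sum.inr 1)).toLinearMap

lemma omegaXY_apply (F : Pxy) : omegaXY F =
    pderiv (Sum.inl 0) (pderiv (Sum.inr 1) F) - pderiv (Sum.inr 0) (pderiv (Sum.inl 1) F) := rfl

lemma deltaXY_apply (F : Pxy) : deltaXY F =
    X (Sum.inl 0) * pderiv (Sum.inr 0) F + X (Sum.inl 1) * pderiv (Sum.inr 1) F := rfl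

lemma deltaYX_apply (F : Pxy) : deltaYX F =
    X (Sum.inr 0) * pderiv (Sum.inl 0) F + X (Sum.inr 1) * pderiv (Sum.inl 1) F := rfl

lemma gammaXY_apply (F : Pxy) : gammaXY F =
    (X (Sum.inl 0) * X (Sum.inr 1) - X (Sum.inr 0) * X (Sum.inl 1)) * F := rfl

/-- Multiplication by a variable and the matching derivative are Fischer adjoint; the next lemma
uses the same fact for Δ. -/
lemma fischer_gammaXY_right (F G : Pxy) : fischer F (gammaXY G) = fischer (omegaXY F) G := by
  rw [omegaXY_apply, fischer_sub_left, fischer_pderiv_left, fischer_pderiv_left,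
    fischer_pderiv_left, fischer_pderiv_left, ← map_sub, gammaXY_apply]
  congr 1
  ring

lemma fischer_deltaYX_right (F G : Pxy) : fischer F (deltaYX G) = fischer (deltaXY F) G := by
  rw [deltaXY_apply, fischer_add_left, fischer_X_mul_left, fischer_X_mul_left,
    fischer_pderiv_left, fischer_pderiv_left, ← map_add, deltaYX_apply]

lemma euler_x {a b : ℕ} {F : Pxy} (hF : F ∈ BiP a b) :
    X (Sum.inl 0) * pderiv (Sum.inl 0) F + X (Sum.inl 1) * pderiv (Sum.inl 1) F = (a : ℂ) • F := by
  -- Forgetting the y-degree leaves an ordinary weight, for which Euler's identity applies.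
  have h : IsWeightedHomogeneous (fun i => (bideg i).1) F a := by
    intro d hd
    have h1 := congrArg Prod.fst (hF hd)
    simpa [Finsupp.weight_apply, Finsupp.sum, Prod.fst_sum] using h1
  have h2 := h.sum_weight_X_mul_pderiv
  simpa [bideg, Fintype.sum_sum_type, Fin.sum_univ_two, ← Nat.cast_smul_eq_nsmul ℂ] using h2

lemma euler_y {a b : ℕ} {F : Pxy} (hF : F ∈ BiP a b) :
    X (Sum.inr 0) * pderiv (Sum.inr 0) F + X (Sum.inr 1) * pderiv (Sum.inr 1) F = (b : ℂ) • F := by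
  have h : IsWeightedHomogeneous (fun i => (bideg i).2) F b := by
    intro d hd
    have h1 := congrArg Prod.snd (hF hd)
    simpa [Finsupp.weight_apply, Finsupp.sum, Prod.snd_sum] using h1
  have h2 := h.sum_weight_X_mul_pderiv
  simpa [bideg, Fintype.sum_sum_type, Fin.sum_univ_two, ← Nat.cast_smul_eq_nsmul ℂ] using h2

/-- The commutator [Ω, Γ] is the sum of the two Euler operators plus 2, a scalar on each bidegree.
-/
lemma omegaXY_gammaXY {a b : ℕ} {F : Pxy} (hF : F ∈ BiP a b) :
    omegaXY (gammaXY F) = gammaXY (omegaXY F) + ((a : ℂ) + b + 2) • F := by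
  have h : omegaXY (gammaXY F) = gammaXY (omegaXY F) +
      (X (Sum.inl 0) * pderiv (Sum.inl 0) F + X (Sum.inl 1) * pderiv (Sum.inl 1) F) +
      (X (Sum.inr 0) * pderiv (Sum.inr 0) F + X (Sum.inr 1) * pderiv (Sum.inr 1) F) + 2 * F := by
    simp only [omegaXY_apply, gammaXY_apply, pderiv_mul, map_add, map_sub, pderiv_X]
    simp
    ring
  rw [h, euler_x hF, euler_y hF, two_mul]
  module

/-- The sl₂ relation: the commutator is the difference of the two Euler operators. -/
lemma deltaXY_deltaYX {a b : ℕ} {F : Pxy} (hF : F ∈ BiP a b) :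
    deltaXY (deltaYX F) = deltaYX (deltaXY F) + ((a : ℂ) - b) • F := by
  have h : deltaXY (deltaYX F) = deltaYX (deltaXY F) +
      (X (Sum.inl 0) * pderiv (Sum.inl 0) F + X (Sum.inl 1) * pderiv (Sum.inl 1) F) -
      (X (Sum.inr 0) * pderiv (Sum.inr 0) F + X (Sum.inr 1) * pderiv (Sum.inr 1) F) := by
    simp only [deltaXY_apply, deltaYX_apply, pderiv_mul, map_add, pderiv_X,
      pderiv_comm (Sum.inr _) (Sum.inl _)]
    simp
    ring
  rw [h, euler_x hF, euler_y hF]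
  module

/-- The commutator of each term of Ω with Δ is ∂²/∂x₁∂x₂, and the two contributions cancel. -/
lemma omegaXY_deltaYX (F : Pxy) : omegaXY (deltaYX F) = deltaYX (omegaXY F) := by
  simp only [omegaXY_apply, deltaYX_apply, pderiv_mul, map_add, map_sub, pderiv_X]
  rw [pderiv_comm (Sum.inr 1) (Sum.inl 0), pderiv_comm (Sum.inr 1) (Sum.inl 1),
    pderiv_comm (Sum.inr 0) (Sum.inl 1)]
  simp only [pderiv_comm (Sum.inr _) (Sum.inl _)]
  rw [pderiv_comm (Sum.inl 1) (Sum.inl 0) (pderiv (Sum.inr 0) F),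
    pderiv_comm (Sum.inl 1) (Sum.inl 0) (pderiv (Sum.inr 1) F),
    pderiv_comm (Sum.inl 1) (Sum.inl 0) F]
  simp
  ring

/-- Ω is moved past one Γ at a time; the scalar is the sum of a + b + 2j + 2 over 0 ≤ j ≤ h. -/
lemma omegaXY_gammaXY_pow {a b : ℕ} {F : Pxy} (hF : F ∈ BiP a b) (h0 : omegaXY F = 0) (h : ℕ) :
    omegaXY ((gammaXY ^ (h + 1)) F) = (((h : ℂ) + 1) * (a + b + h + 2)) • (gammaXY ^ h) F := by
  induction h with
  | zero => simp [omegaXY_gammaXY hF, h0]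
  | succ h ih =>
    rw [pow_succ', Module.End.mul_apply, omegaXY_gammaXY (gammaXY_pow_mem (h + 1) hF), ih, map_smul,
      ← Module.End.mul_apply, ← pow_succ', ← add_smul]
    congr 1
    push_cast
    ring

/-- The same ladder argument; the scalar is the sum of r - 2j over 0 ≤ j ≤ k. -/
lemma deltaXY_deltaYX_pow {r : ℕ} {F : Pxy} (hF : F ∈ BiP r 0) (h0 : deltaXY F = 0) (k : ℕ)
    (hk : k ≤ r) :
    deltaXY ((deltaYX ^ (k + 1)) F) = (((k : ℂ) + 1) * (r - k)) • (deltaYX ^ k) F := by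
  induction k with
  | zero => simp [deltaXY_deltaYX hF, h0]
  | succ k ih =>
    obtain ⟨a, rfl⟩ := Nat.exists_eq_add_of_le' hk
    rw [pow_succ', Module.End.mul_apply, deltaXY_deltaYX (deltaYX_pow_mem (k + 1) hF),
      ih (by omega), map_smul, ← Module.End.mul_apply, ← pow_succ', ← add_smul]
    congr 1
    push_cast
    ring

lemma fischer_gammaXY_pow {a b : ℕ} {F : Pxy} (hF : F ∈ BiP a b) (h0 : omegaXY F = 0) (G : Pxy)
    (h : ℕ) : ((a + b + 1).factorial : ℂ) * fischer ((gammaXY ^ h) F) ((gammaXY ^ h) G) =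
      h.factorial * (a + b + h + 1).factorial * fischer F G := by
  induction h with
  | zero => simp
  | succ h ih =>
    rw [pow_succ' _ h, Module.End.mul_apply _ _ G, fischer_gammaXY_right, ← pow_succ',
      omegaXY_gammaXY_pow hF h0, fischer_smul_left, mul_left_comm, ih,
      show a + b + (h + 1) + 1 = (a + b + h + 1) + 1 by ring, Nat.factorial_succ h,
      Nat.factorial_succ (a + b + h + 1)]
    simp only [map_mul, map_add, map_one, Complex.conj_natCast, Complex.conj_ofNat]
    push_cast
    ring

lemma fischer_deltaYX_pow {r : ℕ} {F : Pxy} (hF : F ∈ BiP r 0) (h0 : deltaXY F = 0) (G : Pxy)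
    (k : ℕ) (hk : k ≤ r) :
    ((r - k).factorial : ℂ) * fischer ((deltaYX ^ k) F) ((deltaYX ^ k) G) =
      k.factorial * r.factorial * fischer F G := by
  induction k with
  | zero => simp
  | succ k ih =>
    obtain ⟨a, rfl⟩ := Nat.exists_eq_add_of_le' hk
    have ih := ih (by omega)
    rw [show a + (k + 1) - k = a + 1 by omega, Nat.factorial_succ a] at ih
    rw [pow_succ' _ k, Module.End.mul_apply _ _ G, fischer_deltaYX_right, ← pow_succ',
      deltaXY_deltaYX_pow hF h0 k (by omega), fischer_smul_left, Nat.add_sub_cancel,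
      Nat.factorial_succ k]
    push_cast at ih ⊢
    simp only [map_mul, map_sub, map_add, map_one, Complex.conj_natCast]
    linear_combination ((k : ℂ) + 1) * ih

lemma pderiv_inr_rename_inl (i : Fin 2) (f : MvPolynomial (Fin 2) ℂ) :
    pderiv (Sum.inr i) (rename Sum.inl f : Pxy) = 0 := by
  classical
  refine pderiv_eq_zero_of_notMem_vars fun h => ?_
  have := vars_rename _ _ h
  simp at this

lemma deltaXY_rename (f : MvPolynomial (Fin 2) ℂ) : deltaXY (rename Sum.inl f) = 0 := by
  simp [deltaXY_apply, pderiv_inr_rename_inl]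

/-- f(x) contains no y, so Ω kills it, and Ω commutes with Δ. This lets the Γ ladder start at Δ^k f.
-/
lemma omegaXY_deltaYX_pow_rename (f : MvPolynomial (Fin 2) ℂ) (k : ℕ) :
    omegaXY ((deltaYX ^ k) (rename Sum.inl f)) = 0 := by
  induction k with
  | zero =>
    rw [pow_zero, Module.End.one_apply, omegaXY_apply, pderiv_comm (Sum.inr 0) (Sum.inl 1)]
    simp [pderiv_inr_rename_inl]
  | succ k ih => rw [pow_succ', Module.End.mul_apply, omegaXY_deltaYX, ih, map_zero]

/-! ### Inner products on `P_m ⊗ P_n` -/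

lemma cf_mono {m k : ℕ} (hk : k < m + 1) (l : Fin (m + 1)) :
    cf k (mono m l) = if k = l then 1 else 0 := by
  rw [cf, mono, coeff_monomial]
  congr 1
  apply propext
  constructor
  · intro h
    have := DFunLike.congr_fun h 0
    rw [expo_zero, expo_zero] at this
    exact this.symm
  · rintro rfl; rfl

lemma inner_mono {m : ℕ} (s s' : Fin (m + 1)) : inner ℂ (mono m s) (mono m s') =
    if s = s' then ((s : ℕ).factorial * (m - s).factorial : ℂ) else 0 := by
  rw [inner_P, Finset.sum_range]
  simp only [cf_mono (Fin.is_lt _), Fin.val_inj]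
  rw [Finset.sum_eq_single s]
  · simp
  · intro b _ hb; simp [hb]
  · simp

lemma multiFactorial_expo4 (a b c d : ℕ) : multiFactorial (expo4 a b c d) =
    a.factorial * b.factorial * (c.factorial * d.factorial) := by
  simp [multiFactorial, expo4, expo, Finsupp.mapDomain_add, Fintype.prod_sum_type]

lemma expo4_injective {m n : ℕ} {s s' : Fin (m + 1)} {t t' : Fin (n + 1)}
    (h : expo4 s (m - s) t (n - t) = expo4 s' (m - s') t' (n - t')) : s = s' ∧ t = t' := by
  have h1 := DFunLike.congr_fun h (Sum.inl 0)
  have h2 := DFunLike.congr_fun h (Sum.inr 0)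
  rw [expo4_inl, expo4_inl] at h1
  rw [expo4_inr, expo4_inr] at h2
  exact ⟨Fin.ext h1, Fin.ext h2⟩

lemma tensor_mono_induction {m n : ℕ} {p : P m ⊗[ℂ] P n → Prop} (zero : p 0)
    (add : ∀ t t', p t → p t' → p (t + t')) (smul : ∀ (c : ℂ) t, p t → p (c • t))
    (mono : ∀ s t, p (mono m s ⊗ₜ mono n t)) (t : P m ⊗[ℂ] P n) : p t := by
  let S : Submodule ℂ (P m ⊗[ℂ] P n) :=
    { carrier := {t | p t}, zero_mem' := zero, add_mem' := fun {a b} => add a b,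
      smul_mem' := smul }
  change t ∈ S
  induction t with
  | zero => exact S.zero_mem
  | add a b ha hb => exact S.add_mem ha hb
  | tmul f g =>
    rw [sum_mono f, sum_mono g]
    simp only [TensorProduct.sum_tmul, TensorProduct.tmul_sum, ← TensorProduct.smul_tmul',
      TensorProduct.tmul_smul]
    exact S.sum_mem fun s _ => S.smul_mem _ (S.sum_mem fun t _ => S.smul_mem _ (mono _ _))

/-- Transfers the inner product to the polynomial ring, where Γ and Δ have explicit adjoints. -/
lemma inner_tensor_eq_fischer {m n : ℕ} (t t' : P m ⊗[ℂ] P n) :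
    inner ℂ t t' = fischer (tensorToPxy m n t) (tensorToPxy m n t') := by
  induction t using tensor_mono_induction with
  | zero => simp [fischer_zero_left]
  | add a b ha hb => rw [inner_add_left, map_add, fischer_add_left, ha, hb]
  | smul c a ha => rw [map_smul, fischer_smul_left, ← ha]; exact inner_smul_left a t' c
  | mono s u =>
    induction t' using tensor_mono_induction with
    | zero => simp
    | add a b ha hb => rw [inner_add_right, map_add, map_add, ha, hb]
    | smul c a ha => rw [map_smul, map_smul, ← ha]; exact inner_smul_right _ a c
    | mono s' u' =>
      rw [TensorProduct.inner_tmul, inner_mono, inner_mono, tensorToPxy_mono, tensorToPxy_mono,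
        fischer_monomial_right, coeff_monomial, multiFactorial_expo4]
      by_cases h : s = s' ∧ u = u'
      · obtain ⟨rfl, rfl⟩ := h
        simp
      · rw [if_neg fun h' => h (expo4_injective h')]
        simp only [map_zero, mul_zero]
        rcases not_and_or.1 h with h | h <;> simp [h]

lemma inner_eq_fischer_rename {m : ℕ} (f g : P m) :
    inner ℂ f g = fischer (rename Sum.inl (f : MvPolynomial (Fin 2) ℂ) : Pxy)
      (rename Sum.inl (g : MvPolynomial (Fin 2) ℂ)) := by
  have h := inner_tensor_eq_fischer (f ⊗ₜ[ℂ] mono 0 0) (g ⊗ₜ[ℂ] mono 0 0)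
  have h1 : ((mono 0 0 : P 0) : MvPolynomial (Fin 2) ℂ) = 1 := by
    simp [mono, expo]
  rw [TensorProduct.inner_tmul, inner_mono, tensorToPxy_tmul, tensorToPxy_tmul, h1] at h
  simpa using h

/-- `α_{m,n,h}` is an isometry. -/
lemma inner_alpha_alpha (m n h r : ℕ) (hh : h ≤ min m n) (hr : r = m + n - 2 * h) (f g : P r) :
    inner ℂ (alpha m n h r hh hr f) (alpha m n h r hh hr g) = inner ℂ f g := by
  obtain ⟨p, rfl⟩ := Nat.exists_eq_add_of_le (hh.trans (min_le_left _ _))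
  obtain ⟨q, rfl⟩ := Nat.exists_eq_add_of_le (hh.trans (min_le_right _ _))
  obtain rfl : r = p + q := by omega
  rw [inner_tensor_eq_fischer, tensorToPxy_alpha, tensorToPxy_alpha, fischer_smul_left, map_smul,
    smul_eq_mul, Complex.conj_ofReal, ← mul_assoc, ← Complex.ofReal_mul, Real.mul_self_sqrt,
    Nat.add_sub_cancel_left, cgCoeff_eq, inner_eq_fischer_rename]
  · have hf : (rename Sum.inl (f : MvPolynomial (Fin 2) ℂ) : Pxy) ∈ BiP (p + q) 0 :=
      rename_inl_mem f
    -- Γ^h contributes h! (p+q+h+1)! / (p+q+1)! and Δ^q contributes q! (p+q)! / p!; their product is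
    -- 1 / c_{m,n,h}.
    have h1 := fischer_gammaXY_pow (deltaYX_pow_mem q hf)
      (omegaXY_deltaYX_pow_rename (f : MvPolynomial (Fin 2) ℂ) q)
      ((deltaYX ^ q) (rename Sum.inl (g : MvPolynomial (Fin 2) ℂ))) h
    have h2 := fischer_deltaYX_pow hf (deltaXY_rename _)
      (rename Sum.inl (g : MvPolynomial (Fin 2) ℂ)) q (by omega)
    rw [Nat.add_sub_cancel] at h2
    rw [zero_add, Nat.factorial_succ (p + q), show p + q + h + 1 = p + q + h + 1 from rfl] at h1
    push_cast at h1 ⊢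
    have n1 : (p.factorial : ℂ) ≠ 0 := by exact_mod_cast p.factorial_ne_zero
    have n2 : (q.factorial : ℂ) ≠ 0 := by exact_mod_cast q.factorial_ne_zero
    have n3 : (h.factorial : ℂ) ≠ 0 := by exact_mod_cast h.factorial_ne_zero
    have n4 : ((p + q + h + 1).factorial : ℂ) ≠ 0 := by exact_mod_cast Nat.factorial_ne_zero _
    have n5 : ((p + q).factorial : ℂ) ≠ 0 := by exact_mod_cast Nat.factorial_ne_zero _
    rw [div_mul_eq_mul_div, div_eq_iff (by positivity)]
    refine mul_left_cancel₀ n5 ?_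
    linear_combination (p.factorial : ℂ) * h1 +
      (h.factorial : ℂ) * ((p + q + h + 1).factorial : ℂ) * h2
  · rw [cgCoeff_eq]
    positivity

/-! ### Powers of linear forms -/

/-- The power `(a₁ x₁ + a₂ x₂) ^ m` of a linear form. -/
def linPow (a : Fin 2 → ℂ) (m : ℕ) : P m :=
  ⟨(C (a 0) * X 0 + C (a 1) * X 1) ^ m, by
    have h : (C (a 0) * X 0 + C (a 1) * X 1 : MvPolynomial (Fin 2) ℂ).IsHomogeneous 1 :=
      (isHomogeneous_C_mul_X _ _).add (isHomogeneous_C_mul_X _ _)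
    simpa using h.pow m⟩

lemma coe_mono (m : ℕ) (l : Fin (m + 1)) :
    (mono m l : MvPolynomial (Fin 2) ℂ) = X 0 ^ (l : ℕ) * X 1 ^ (m - l) := by
  simp [mono, expo, X_pow_eq_monomial, monomial_mul]

lemma linPow_eq_sum (a : Fin 2 → ℂ) (m : ℕ) : linPow a m =
    ∑ l : Fin (m + 1), (a 0 ^ (l : ℕ) * a 1 ^ (m - l) * (m.choose l : ℂ)) • mono m l := by
  apply Subtype.ext
  rw [Submodule.coe_sum]
  simp only [Submodule.coe_smul, coe_mono]
  change (C (a 0) * X 0 + C (a 1) * X 1) ^ m = _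
  rw [add_pow, Finset.sum_range]
  refine Finset.sum_congr rfl fun l _ => ?_
  simp only [mul_pow, smul_eq_C_mul, C_mul, C_pow, map_natCast]
  ring

/-- Powers of linear forms are reproducing kernels. -/
lemma inner_linPow (a : Fin 2 → ℂ) {m : ℕ} (f : P m) : inner ℂ (linPow a m) f =
    m.factorial * eval (fun i => starRingEnd ℂ (a i)) (f : MvPolynomial (Fin 2) ℂ) := by
  have key (l : Fin (m + 1)) : inner ℂ (linPow a m) (mono m l) = m.factorial *
      eval (fun i => starRingEnd ℂ (a i)) (mono m l : MvPolynomial (Fin 2) ℂ) := by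
    rw [linPow_eq_sum, sum_inner]
    simp only [inner_smul_left, inner_mono]
    rw [Finset.sum_eq_single l]
    · rw [← Nat.choose_mul_factorial_mul_factorial (Nat.le_of_lt_succ l.is_lt), coe_mono]
      simp
      ring
    · intro b _ hb; simp [hb]
    · simp
  rw [sum_mono f, inner_sum, Submodule.coe_sum, map_sum, Finset.mul_sum]
  refine Finset.sum_congr rfl fun l _ => ?_
  rw [inner_smul_right, key, Submodule.coe_smul, smul_eval]
  ring

lemma inner_linPow_tmul (a b : Fin 2 → ℂ) {m n : ℕ} (t : P m ⊗[ℂ] P n) :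
    inner ℂ (linPow a m ⊗ₜ[ℂ] linPow b n) t = m.factorial * n.factorial *
      eval (Sum.elim (fun i => starRingEnd ℂ (a i)) (fun i => starRingEnd ℂ (b i)))
        (tensorToPxy m n t) := by
  induction t with
  | zero => simp
  | add t t' h h' => rw [inner_add_right, h, h', map_add, map_add, mul_add]
  | tmul f g =>
    rw [TensorProduct.inner_tmul, inner_linPow, inner_linPow, tensorToPxy_tmul, map_mul,
      eval_rename, eval_rename, Sum.elim_comp_inl, Sum.elim_comp_inr]
    ring

/-- Powers of linear forms span P_m: by the reproducing property, a form orthogonal to all of them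
vanishes at every point. -/
lemma linPow_induction {m : ℕ} {p : P m → Prop} (zero : p 0)
    (add : ∀ f g, p f → p g → p (f + g)) (smul : ∀ (c : ℂ) f, p f → p (c • f))
    (linPow : ∀ a, p (linPow a m)) (f : P m) : p f := by
  let S : Submodule ℂ (P m) :=
    { carrier := {t | p t}, zero_mem' := zero, add_mem' := fun {a b} => add a b,
      smul_mem' := smul }
  suffices S = ⊤ by
    have h : f ∈ S := by rw [this]; trivial
    exact h
  rw [← Submodule.orthogonal_eq_bot_iff, Submodule.eq_bot_iff]
  intro g hg
  apply Subtype.ext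
  refine MvPolynomial.funext fun x => ?_
  have h := (Submodule.mem_orthogonal S g).1 hg _ (linPow fun i => starRingEnd ℂ (x i))
  rw [inner_linPow] at h
  simpa [Nat.factorial_ne_zero] using h

/-! ### Values of α on powers of linear forms -/

/-- Each Δ replaces one factor d·x by d·y, with as many choices as there are factors left. -/
lemma deltaYX_pow_linPow (d : Fin 2 → ℂ) (p k : ℕ) :
    (deltaYX ^ k) (rename Sum.inl (linPow d (p + k) : MvPolynomial (Fin 2) ℂ)) =
      ((p + k).descFactorial k : ℂ) •
        ((C (d 0) * X (Sum.inr 0) + C (d 1) * X (Sum.inr 1)) ^ k *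
          (C (d 0) * X (Sum.inl 0) + C (d 1) * X (Sum.inl 1)) ^ p) := by
  induction k generalizing p with
  | zero => simp [linPow]
  | succ k ih =>
    rw [show p + (k + 1) = p + 1 + k by ring, pow_succ', Module.End.mul_apply, ih, map_smul,
      Nat.descFactorial_succ, Nat.add_sub_cancel, Nat.cast_mul, mul_comm ((p + 1 : ℕ) : ℂ),
      mul_smul]
    congr 1
    rw [deltaYX_apply]
    simp only [pderiv_mul, pderiv_pow, map_add, pderiv_X, pderiv_C, smul_eq_C_mul]
    simp
    ring

lemma eval_gammaXY_pow (v : Fin 2 ⊕ Fin 2 → ℂ) (F : Pxy) (h : ℕ) : eval v ((gammaXY ^ h) F) =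
    (v (Sum.inl 0) * v (Sum.inr 1) - v (Sum.inr 0) * v (Sum.inl 1)) ^ h * eval v F := by
  induction h with
  | zero => simp
  | succ h ih =>
    rw [pow_succ', Module.End.mul_apply, gammaXY_apply, map_mul, ih]
    simp
    ring

lemma eval_alpha_linPow {m n h r p q : ℕ} (hm : m = h + p) (hn : n = h + q) (hr' : r = p + q)
    (hh hr) (d : Fin 2 → ℂ) (v : Fin 2 ⊕ Fin 2 → ℂ) :
    eval v (tensorToPxy m n (alpha m n h r hh hr (linPow d r))) =
    (Real.sqrt (cgCoeff m n h) : ℝ) * ((r.descFactorial q : ℕ) : ℂ) *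
      (v (Sum.inl 0) * v (Sum.inr 1) - v (Sum.inr 0) * v (Sum.inl 1)) ^ h *
      (d 0 * v (Sum.inr 0) + d 1 * v (Sum.inr 1)) ^ q *
      (d 0 * v (Sum.inl 0) + d 1 * v (Sum.inl 1)) ^ p := by
  subst hm hn hr'
  rw [tensorToPxy_alpha, smul_eval, eval_gammaXY_pow, Nat.add_sub_cancel_left, deltaYX_pow_linPow,
    smul_eval]
  simp
  ring

lemma inner_smul_left_tensor {m n : ℕ} (c : ℂ) (s t : P m ⊗[ℂ] P n) :
    inner ℂ (c • s) t = starRingEnd ℂ c * inner ℂ s t := inner_smul_left s t c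

lemma inner_smul_right_tensor {m n : ℕ} (c : ℂ) (s t : P m ⊗[ℂ] P n) :
    inner ℂ s (c • t) = c * inner ℂ s t := inner_smul_right s t c

lemma inner_conj_symm_tensor {m n : ℕ} (s t : P m ⊗[ℂ] P n) :
    starRingEnd ℂ (inner ℂ t s) = inner ℂ s t := inner_conj_symm s t

/-! ### An orthonormal basis of `P_n` and an antiunitary map -/

/-- The normalized monomials. -/
def stdBasis (n : ℕ) : OrthonormalBasis (Fin (n + 1)) ℂ (P n) :=
  OrthonormalBasis.mk (v := fun t : Fin (n + 1) =>
      (((Real.sqrt ((t : ℕ).factorial * (n - t).factorial))⁻¹ : ℝ) : ℂ) • mono n t)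
    (by
      rw [orthonormal_iff_ite]
      intro s t
      rw [inner_smul_left, inner_smul_right, inner_mono]
      split_ifs with h
      · subst h
        rw [Complex.conj_ofReal, ← mul_assoc, ← Complex.ofReal_mul, ← mul_inv,
          Real.mul_self_sqrt (by positivity)]
        push_cast
        refine inv_mul_cancel₀ (mul_ne_zero ?_ ?_) <;> exact_mod_cast Nat.factorial_ne_zero _
      · simp)
    (by
      intro f _
      rw [sum_mono f]
      refine Submodule.sum_mem _ fun t _ => Submodule.smul_mem _ _ ?_
      have h : (((Real.sqrt ((t : ℕ).factorial * (n - t).factorial))⁻¹ : ℝ) : ℂ) ≠ 0 := by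
        rw [Complex.ofReal_ne_zero]
        positivity
      rw [← inv_smul_smul₀ h (mono n t)]
      exact Submodule.smul_mem _ _ (Submodule.subset_span ⟨t, rfl⟩))

lemma stdBasis_apply (n : ℕ) (t : Fin (n + 1)) : stdBasis n t =
    (((Real.sqrt ((t : ℕ).factorial * (n - t).factorial))⁻¹ : ℝ) : ℂ) • mono n t := by
  simp [stdBasis]

/-- The conjugate linear map that takes `p(y₁, y₂)` to `p̄(y₂, -y₁)`, up to the sign `(-1) ^ n`. -/
def twist (n : ℕ) : P n →ₗ⋆[ℂ] P n where
  toFun p := ∑ t : Fin (n + 1), ((-1) ^ (t : ℕ) * starRingEnd ℂ (cf t p)) • mono n t.rev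
  map_add' p q := by
    rw [← Finset.sum_add_distrib]
    refine Finset.sum_congr rfl fun t _ => ?_
    rw [← add_smul]
    simp [cf, mul_add]
  map_smul' c p := by
    rw [Finset.smul_sum]
    refine Finset.sum_congr rfl fun t _ => ?_
    rw [smul_smul]
    simp [cf, mul_left_comm]

lemma twist_apply (n : ℕ) (p : P n) : twist n p =
    ∑ t : Fin (n + 1), ((-1) ^ (t : ℕ) * starRingEnd ℂ (cf t p)) • mono n t.rev := rfl

lemma twist_mono (n : ℕ) (t : Fin (n + 1)) :
    twist n (mono n t) = (-1 : ℂ) ^ (t : ℕ) • mono n t.rev := by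
  rw [twist_apply, Finset.sum_eq_single t]
  · simp [cf_mono t.is_lt]
  · intro s _ hs
    simp [cf_mono s.is_lt, Fin.val_inj, hs]
  · simp

lemma twist_stdBasis (n : ℕ) (t : Fin (n + 1)) :
    twist n (stdBasis n t) = (-1 : ℂ) ^ (t : ℕ) • stdBasis n t.rev := by
  rw [stdBasis_apply, stdBasis_apply, map_smulₛₗ, twist_mono, smul_comm, Complex.conj_ofReal,
    Fin.val_rev, show n + 1 - ((t : ℕ) + 1) = n - t by omega,
    show n - (n - (t : ℕ)) = t by omega, mul_comm ((t : ℕ).factorial : ℝ)]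

/-- The twist rotates the coefficient vector by a quarter turn, so dot products become brackets and
conversely. This is what exchanges the exponents h and n - h. -/
lemma twist_linPow (b : Fin 2 → ℂ) (n : ℕ) : twist n (linPow b n) =
    linPow ![starRingEnd ℂ (b 1), -starRingEnd ℂ (b 0)] n := by
  rw [linPow_eq_sum b, linPow_eq_sum, map_sum, ← Equiv.sum_comp Fin.revPerm]
  refine Finset.sum_congr rfl fun t _ => ?_
  have ht : (t : ℕ) ≤ n := Nat.le_of_lt_succ t.is_lt
  rw [map_smulₛₗ, twist_mono, smul_smul, Fin.revPerm_apply, Fin.rev_rev, Fin.val_rev,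
    show n + 1 - ((t : ℕ) + 1) = n - t by omega, Nat.choose_symm ht, Nat.sub_sub_self ht]
  congr 1
  simp only [map_mul, map_pow, map_natCast, Matrix.cons_val_zero, Matrix.cons_val_one]
  rw [neg_pow (starRingEnd ℂ (b 0))]
  ring

/-- The symmetry between `α_{m,n,h}` and `α_{r,n,n-h}`. -/
lemma inner_tmul_alpha (m n h r h' : ℕ) (hn : h + h' = n) (hh hr hh' hr')
    (g : P m) (u : P n) (f : P r) :
    inner ℂ (g ⊗ₜ[ℂ] u) (alpha m n h r hh hr f) =
      ((-1) ^ h' * Real.sqrt (((r : ℝ) + 1) / ((m : ℝ) + 1)) : ℝ) *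
        inner ℂ (alpha r n h' m hh' hr' g) (f ⊗ₜ[ℂ] twist n u) := by
  obtain ⟨p, rfl⟩ := Nat.exists_eq_add_of_le (hh.trans (min_le_left _ _))
  subst hn
  obtain rfl : r = p + h' := by omega
  -- Both sides are conjugate linear in g and u and linear in f, so powers of linear forms suffice.
  induction g using linPow_induction with
  | zero => simp
  | add x y hx hy => rw [TensorProduct.add_tmul, inner_add_left, map_add, inner_add_left, hx, hy,
      mul_add]
  | smul c x hx =>
    rw [map_smul, ← TensorProduct.smul_tmul', inner_smul_left_tensor, inner_smul_left_tensor, hx,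
      mul_left_comm]
  | linPow a =>
    induction u using linPow_induction with
    | zero => simp
    | add x y hx hy => rw [TensorProduct.tmul_add, inner_add_left, map_add, TensorProduct.tmul_add,
        inner_add_right, hx, hy, mul_add]
    | smul c x hx =>
      rw [map_smulₛₗ, TensorProduct.tmul_smul, TensorProduct.tmul_smul, inner_smul_left_tensor,
        inner_smul_right_tensor, hx, mul_left_comm]
    | linPow b =>
      induction f using linPow_induction with
      | zero => simp
      | add x y hx hy => rw [TensorProduct.add_tmul, map_add, inner_add_right,
          inner_add_right, hx, hy, mul_add]
      | smul c x hx =>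
        rw [map_smul, ← TensorProduct.smul_tmul', inner_smul_right_tensor,
          inner_smul_right_tensor, hx, mul_left_comm]
      | linPow d =>
        -- The closed forms differ only in one linear factor; this is the origin of (r+1)/(m+1).
        have hc : cgCoeff (h + p) (h + h') h = ((((p + h' : ℕ) : ℝ) + 1) /
            (((h + p : ℕ) : ℝ) + 1)) * cgCoeff (p + h') (h + h') h' := by
          have h1 := cgCoeff_eq h p h'
          have h2 := cgCoeff_eq h' p h
          rw [add_comm h' p, add_comm h' h] at h2
          rw [h1, h2, show p + h + h' + 1 = p + h' + h + 1 by ring]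
          have : ((p + h' + h + 1).factorial : ℝ) ≠ 0 := by positivity
          push_cast
          field_simp
          ring
        have hd1 := Nat.factorial_mul_descFactorial (show h' ≤ p + h' by omega)
        have hd2 := Nat.factorial_mul_descFactorial (show h ≤ h + p by omega)
        rw [Nat.add_sub_cancel] at hd1
        rw [Nat.add_sub_cancel_left] at hd2
        -- Both sides equal m! r! / p!.
        have hd : (((p + h').descFactorial h' : ℕ) : ℂ) * ((h + p).factorial : ℕ) =
            (((h + p).descFactorial h : ℕ) : ℂ) * ((p + h').factorial : ℕ) := by
          rw [← hd1, ← hd2]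
          push_cast
          ring
        rw [inner_linPow_tmul, eval_alpha_linPow rfl rfl rfl, hc, Real.sqrt_mul (by positivity),
          twist_linPow, ← inner_conj_symm_tensor, inner_linPow_tmul,
          eval_alpha_linPow (p := p) (q := h) (add_comm _ _) (add_comm _ _) (add_comm _ _)]
        simp only [map_mul, map_pow, map_add, map_sub, map_neg, map_natCast, Complex.conj_conj,
          Complex.conj_ofReal, Sum.elim_inl, Sum.elim_inr, Matrix.cons_val_zero,
          Matrix.cons_val_one]
        push_cast
        generalize (Real.sqrt (((p : ℝ) + h' + 1) / ((h : ℝ) + p + 1)) : ℂ) = κ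
        generalize (Real.sqrt (cgCoeff (p + h') (h + h') h') : ℂ) = c
        generalize starRingEnd ℂ (a 0) = a0
        generalize starRingEnd ℂ (a 1) = a1
        generalize starRingEnd ℂ (b 0) = b0
        generalize starRingEnd ℂ (b 1) = b1
        have e : (d 0 * (-b0) - b1 * d 1) ^ h' = (-1) ^ h' * (d 0 * b0 + d 1 * b1) ^ h' := by
          rw [← mul_pow]
          ring
        have sq : (-1 : ℂ) ^ h' * (-1) ^ h' = 1 := by rw [← mul_pow]; simp
        rw [e, show a0 * b1 + a1 * -b0 = a0 * b1 - b0 * a1 by ring,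
          show a0 * d 0 + a1 * d 1 = d 0 * a0 + d 1 * a1 by ring]
        generalize (a0 * b1 - b0 * a1) ^ h = x
        generalize (d 0 * b0 + d 1 * b1) ^ h' = y
        generalize (d 0 * a0 + d 1 * a1) ^ p = z
        linear_combination ((h + h').factorial * κ * c * x * y * z) * hd -
          ((p + h').factorial * (h + h').factorial * ((h + p).descFactorial h : ℕ) *
            κ * c * x * y * z) * sq

/-! ### Partial traces and Kraus decompositions -/

section General

variable {H K : Type*} [NormedAddCommGroup H] [InnerProductSpace ℂ H] [FiniteDimensional ℂ H]
  [NormedAddCommGroup K] [InnerProductSpace ℂ K] [FiniteDimensional ℂ K]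

lemma inner_partialTrace {ι : Type*} [Fintype ι] (b : OrthonormalBasis ι ℂ K)
    (M : H ⊗[ℂ] K →ₗ[ℂ] H ⊗[ℂ] K) (u v : H) :
    inner ℂ u (partialTrace H K M v) = ∑ t, inner ℂ (u ⊗ₜ[ℂ] b t) (M (v ⊗ₜ[ℂ] b t)) := by
  obtain ⟨x, rfl⟩ := (homTensorHomEquiv ℂ H K H K).surjective M
  induction x with
  | zero => simp
  | add x y hx hy =>
    simp only [map_add, LinearMap.add_apply, inner_add_right, hx, hy, Finset.sum_add_distrib]
  | tmul A B =>
    have h : homTensorHomEquiv ℂ H K H K (A ⊗ₜ B) = TensorProduct.map A B := by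
      rw [homTensorHomEquiv_apply]; rfl
    rw [h, partialTrace_map, LinearMap.smul_apply, inner_smul_right,
      LinearMap.trace_eq_sum_inner B b, Finset.sum_mul]
    refine Finset.sum_congr rfl fun t _ => ?_
    rw [TensorProduct.map_tmul, TensorProduct.inner_tmul, mul_comm]

/-- Partial trace is dual to A ↦ A ⊗ 1; on simple tensors both sides are tr(AC) tr(D). -/
lemma trace_comp_partialTrace (A : H →ₗ[ℂ] H) (M : H ⊗[ℂ] K →ₗ[ℂ] H ⊗[ℂ] K) :
    LinearMap.trace ℂ H (A ∘ₗ partialTrace H K M) =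
      LinearMap.trace ℂ (H ⊗[ℂ] K) (TensorProduct.map A LinearMap.id ∘ₗ M) := by
  obtain ⟨x, rfl⟩ := (homTensorHomEquiv ℂ H K H K).surjective M
  induction x with
  | zero => simp
  | add x y hx hy => simp only [map_add, LinearMap.comp_add, hx, hy]
  | tmul C D =>
    have h : homTensorHomEquiv ℂ H K H K (C ⊗ₜ D) = TensorProduct.map C D := by
      rw [homTensorHomEquiv_apply]; rfl
    rw [h, partialTrace_map, LinearMap.comp_smul, map_smul, ← TensorProduct.map_comp,
      LinearMap.id_comp, LinearMap.trace_tensorProduct', smul_eq_mul, mul_comm]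

lemma trace_partialTrace (M : H ⊗[ℂ] K →ₗ[ℂ] H ⊗[ℂ] K) :
    LinearMap.trace ℂ H (partialTrace H K M) = LinearMap.trace ℂ (H ⊗[ℂ] K) M := by
  simpa using trace_comp_partialTrace LinearMap.id M

/-- A map with a Kraus decomposition is completely positive. -/
lemma isCompletelyPositive_of_kraus {ι : Type*} [Fintype ι] (V : ι → K →ₗ[ℂ] H)
    (Φ : (H →ₗ[ℂ] H) →ₗ[ℂ] (K →ₗ[ℂ] K))
    (hΦ : ∀ A, Φ A = ∑ t, LinearMap.adjoint (V t) ∘ₗ A ∘ₗ V t) : IsCompletelyPositive Φ := by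
  intro k _ M hM
  -- The ampliation has Kraus operators V t ⊗ 1.
  have key : ampliation Φ k M = ∑ t, LinearMap.adjoint (TensorProduct.map (V t) LinearMap.id) ∘ₗ
      M ∘ₗ TensorProduct.map (V t) (LinearMap.id : EuclideanSpace ℂ (Fin k) →ₗ[ℂ] _) := by
    obtain ⟨x, rfl⟩ := (homTensorHomEquiv ℂ H (EuclideanSpace ℂ (Fin k)) H
      (EuclideanSpace ℂ (Fin k))).surjective M
    -- Positivity is not inherited by the summands of a tensor decomposition.
    clear hM
    induction x with
    | zero => simp
    | add x y hx hy =>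
      rw [map_add, map_add, hx, hy, ← Finset.sum_add_distrib]
      simp only [LinearMap.add_comp, LinearMap.comp_add]
    | tmul C D =>
      simp only [ampliation, LinearMap.comp_apply, LinearEquiv.coe_coe,
        LinearEquiv.symm_apply_apply, LinearMap.rTensor_tmul, hΦ, TensorProduct.sum_tmul, map_sum]
      refine Finset.sum_congr rfl fun t _ => ?_
      rw [homTensorHomEquiv_apply, homTensorHomEquiv_apply, TensorProduct.adjoint_map]
      refine TensorProduct.ext' fun v w => ?_
      simp
  rw [key]
  exact LinearMap.isPositive_sum _ fun t _ => hM.adjoint_conj _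

end General

/-! ### The dual of an EPOSIC channel -/

/-- The Kraus operators of `Φ_{m,n,h}`. -/
def kraus (m n h r : ℕ) (hh : h ≤ min m n) (hr : r = m + n - 2 * h) (t : Fin (n + 1)) :
    P m →ₗ[ℂ] P r :=
  LinearMap.adjoint (alpha m n h r hh hr) ∘ₗ (TensorProduct.mk ℂ (P m) (P n)).flip (stdBasis n t)

lemma kraus_apply (m n h r : ℕ) (hh hr) (t : Fin (n + 1)) (f : P m) :
    kraus m n h r hh hr t f =
      LinearMap.adjoint (alpha m n h r hh hr) (f ⊗ₜ[ℂ] stdBasis n t) := rfl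

lemma inner_Phi (m n h r : ℕ) (hh hr) (A : P r →ₗ[ℂ] P r) (u v : P m) :
    inner ℂ u (Phi m n h r hh hr A v) =
      ∑ t, inner ℂ (kraus m n h r hh hr t u) (A (kraus m n h r hh hr t v)) := by
  rw [Phi_apply, inner_partialTrace (stdBasis n)]
  refine Finset.sum_congr rfl fun t _ => ?_
  rw [kraus_apply, LinearMap.adjoint_inner_left]
  rfl

lemma isCompletelyPositive_Phi (m n h r : ℕ) (hh hr) :
    IsCompletelyPositive (Phi m n h r hh hr) := by
  refine isCompletelyPositive_of_kraus (kraus m n h r hh hr) _ fun A => ?_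
  refine LinearMap.ext fun v => ext_inner_left ℂ fun u => ?_
  rw [inner_Phi, LinearMap.sum_apply, inner_sum]
  refine Finset.sum_congr rfl fun t _ => ?_
  rw [LinearMap.comp_apply, LinearMap.adjoint_inner_right, LinearMap.comp_apply]

lemma adjoint_alpha_comp_alpha (m n h r : ℕ) (hh hr) :
    LinearMap.adjoint (alpha m n h r hh hr) ∘ₗ alpha m n h r hh hr = LinearMap.id := by
  refine LinearMap.ext fun v => ext_inner_left ℂ fun u => ?_
  rw [LinearMap.comp_apply, LinearMap.adjoint_inner_right, inner_alpha_alpha, LinearMap.id_apply]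

/-- Cyclicity of the trace together with α*α = 1. -/
lemma trace_Phi (m n h r : ℕ) (hh hr) (A : P r →ₗ[ℂ] P r) :
    LinearMap.trace ℂ (P m) (Phi m n h r hh hr A) = LinearMap.trace ℂ (P r) A := by
  rw [Phi_apply, trace_partialTrace, LinearMap.trace_comp_comm', LinearMap.comp_assoc,
    adjoint_alpha_comp_alpha, LinearMap.comp_id]

lemma twist_eq_sum (n : ℕ) (u : P n) : twist n u =
    ∑ t : Fin (n + 1), ((-1) ^ (t : ℕ) * inner ℂ u (stdBasis n t)) • stdBasis n t.rev := by
  conv_lhs => rw [← (stdBasis n).sum_repr' u]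
  rw [map_sum]
  refine Finset.sum_congr rfl fun t _ => ?_
  rw [map_smulₛₗ, twist_stdBasis, smul_smul, inner_conj_symm, mul_comm]

/-- The crossing symmetry read in coordinates: the components of α f along the basis of P_n are, up
to a common constant and signs, the opposite Kraus operators applied to f. The index is reversed
because the twist reverses the basis. -/
lemma alpha_eq_sum (m n h r h' : ℕ) (hn : h + h' = n) (hh hr hh' hr') (f : P r) :
    alpha m n h r hh hr f =
      (((-1) ^ h' * Real.sqrt (((r : ℝ) + 1) / ((m : ℝ) + 1)) : ℝ) : ℂ) •
        ∑ t : Fin (n + 1), ((-1 : ℂ) ^ (t : ℕ) • kraus r n h' m hh' hr' t.rev f) ⊗ₜ[ℂ]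
          stdBasis n t := by
  refine TensorProduct.ext_iff_inner_left.2 fun g u => ?_
  rw [inner_tmul_alpha m n h r h' hn hh hr hh' hr', inner_smul_right_tensor, twist_eq_sum,
    TensorProduct.tmul_sum, inner_sum, inner_sum]
  congr 1
  refine Finset.sum_congr rfl fun t _ => ?_
  rw [TensorProduct.tmul_smul, inner_smul_right_tensor, TensorProduct.inner_tmul, inner_smul_right,
    kraus_apply, LinearMap.adjoint_inner_right]
  ring

/-- When `alpha_eq_sum` is inserted on both sides, orthonormality keeps the diagonal terms, the
signs square to 1 and the constant squares to (r+1)/(m+1). -/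
lemma smul_Phi_eq (m n h r h' : ℕ) (hn : h + h' = n) (hh hr hh' hr') (B : P m →ₗ[ℂ] P m) :
    (((r : ℂ) + 1) / ((m : ℂ) + 1)) • Phi r n h' m hh' hr' B =
      LinearMap.adjoint (alpha m n h r hh hr) ∘ₗ TensorProduct.map B LinearMap.id ∘ₗ
        alpha m n h r hh hr := by
  refine LinearMap.ext fun v => ext_inner_left ℂ fun u => ?_
  have hκ : (((-1) ^ h' * Real.sqrt (((r : ℝ) + 1) / ((m : ℝ) + 1)) : ℝ) : ℂ) *
      (((-1) ^ h' * Real.sqrt (((r : ℝ) + 1) / ((m : ℝ) + 1)) : ℝ) : ℂ) =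
      ((r : ℂ) + 1) / ((m : ℂ) + 1) := by
    rw [← Complex.ofReal_mul, mul_mul_mul_comm, Real.mul_self_sqrt (by positivity), ← mul_pow]
    simp
  rw [LinearMap.smul_apply, inner_smul_right, inner_Phi, LinearMap.comp_apply,
    LinearMap.adjoint_inner_right, LinearMap.comp_apply,
    alpha_eq_sum m n h r h' hn hh hr hh' hr' u, alpha_eq_sum m n h r h' hn hh hr hh' hr' v,
    map_smul, inner_smul_left_tensor, inner_smul_right_tensor, Complex.conj_ofReal, ← mul_assoc, hκ,
    map_sum, sum_inner, ← Equiv.sum_comp Fin.revPerm]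
  congr 1
  refine Finset.sum_congr rfl fun t _ => ?_
  rw [inner_sum, Finset.sum_eq_single t]
  · have sq : (-1 : ℂ) ^ (t : ℕ) * (-1) ^ (t : ℕ) = 1 := by rw [← mul_pow]; simp
    rw [TensorProduct.map_tmul, TensorProduct.inner_tmul, LinearMap.id_apply, map_smul,
      inner_smul_left, inner_smul_right, orthonormal_iff_ite.1 (stdBasis n).orthonormal, if_pos rfl]
    simp only [Fin.revPerm_apply, map_pow, map_neg, map_one, mul_one, ← mul_assoc, sq, one_mul]
  · intro s _ hs
    rw [TensorProduct.map_tmul, TensorProduct.inner_tmul, LinearMap.id_apply,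
      orthonormal_iff_ite.1 (stdBasis n).orthonormal, if_neg hs.symm, mul_zero]
  · simp

/-- Cyclicity of the trace identifies the dual with B ↦ α*(B ⊗ 1)α. Keeping h' free with h + h' = n,
instead of n - h, allows h' = h when n = 2h. -/
lemma dualMap_Phi (m n h r h' : ℕ) (hn : h + h' = n) (hh hr hh' hr') :
    dualMap (Phi m n h r hh hr) = (((r : ℂ) + 1) / ((m : ℂ) + 1)) • Phi r n h' m hh' hr' := by
  symm
  rw [eq_dualMap_iff]
  intro A B
  rw [LinearMap.smul_apply, smul_Phi_eq m n h r h' hn hh hr, Phi_apply, trace_comp_partialTrace,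
    LinearMap.adjoint_comp, LinearMap.adjoint_comp, TensorProduct.adjoint_map,
    LinearMap.adjoint_adjoint, LinearMap.adjoint_id, ← LinearMap.comp_assoc, ← LinearMap.comp_assoc,
    LinearMap.trace_comp_comm']
  simp only [LinearMap.comp_assoc]

lemma finrank_P (m : ℕ) : Module.finrank ℂ (P m) = m + 1 := by
  rw [Module.finrank_eq_card_basis (stdBasis m).toBasis, Fintype.card_fin]

lemma isChannel_dualMap_Phi_iff (m n h r : ℕ) (hh : h ≤ min m n) (hr : r = m + n - 2 * h) :
    IsChannel (dualMap (Phi m n h r hh hr)) ↔ n = 2 * h := by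
  rw [dualMap_Phi m n h r (n - h) (by omega) hh hr (by omega) (by omega)]
  constructor
  · rintro ⟨-, htr⟩
    -- The identity of P_m has trace m + 1, while its image under the dual has trace r + 1.
    have h1 := htr LinearMap.id
    have h2 : (m : ℂ) + 1 ≠ 0 := Nat.cast_add_one_ne_zero m
    rw [LinearMap.smul_apply, map_smul, trace_Phi, LinearMap.trace_id, finrank_P, smul_eq_mul,
      Nat.cast_add_one, div_mul_cancel₀ _ h2] at h1
    have h3 : r = m := by exact_mod_cast add_right_cancel h1
    omega
  · intro hn
    obtain rfl : r = m := by omega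
    rw [div_self (Nat.cast_add_one_ne_zero r), one_smul]
    exact ⟨isCompletelyPositive_Phi _ _ _ _ _ _, trace_Phi _ _ _ _ _ _⟩

end

end Eposic

theorem corollary5p6 (m n h r : ℕ) (hh : h ≤ min m n) (hr : r = m + n - 2 * h) :
    Eposic.dualMap (Eposic.Phi m n h r hh hr) =
        (((r : ℂ) + 1) / ((m : ℂ) + 1)) •
          Eposic.Phi r n (n - h) m (by omega) (by omega) ∧
      (Eposic.IsChannel (Eposic.dualMap (Eposic.Phi m n h r hh hr)) ↔ n = 2 * h) ∧
      (∀ hn : n = 2 * h,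
        Eposic.dualMap (Eposic.Phi m n h m hh (by omega)) =
          Eposic.Phi m (2 * h) h m (by omega) (by omega)) := by
  refine ⟨Eposic.dualMap_Phi m n h r (n - h) (by omega) hh hr _ _,
    Eposic.isChannel_dualMap_Phi_iff m n h r hh hr, ?_⟩
  rintro rfl
  rw [Eposic.dualMap_Phi m (2 * h) h m h (by omega) hh (by omega) hh (by omega),
    div_self (Nat.cast_add_one_ne_zero m), one_smul]
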